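/- Consider $N$ products and $K$ display positions. A feasible decision is a pair $(S,\sigma)$ with $S\subseteq[N]$, $|S|\le K$, and $\sigma:S\to[K]$ injective. An instance of the general position-effects model consists of known revenues $r_i\in[0,1]$ ($i\in[N]$) and unknown attractions $v_{i,k}\in(0,1]$ ($i\in[N]$, $k\in[K]$). When $(S,\sigma)$ is displayed, the customer buys $i\in S$ with probability $$\mathbb P(i\mid S,\sigma)=\frac{v_{i,\sigma(i)}}{1+\sum_{j\in S}v_{j,\sigma(j)}}$$ and buys nothing (outcome $0$) with the remaining probability $1/\bigl(1+\sum_{j\in S}v_{j,\sigma(j)}\bigr)$. The expected revenue is $R(S,\sigma)=\sum_{i\in S}r_i\,\mathbb P(i\mid S,\sigma)$. An admissible policy $\pi$ chooses in each round $t=1,\dots,T$ a feasible decision $(S_t,\sigma_t)$, possibly at random, on the basis of the revenues and of the past observations $(S_s,\sigma_s,i_s)_{s<t}$, where $i_s\in S_s\cup\{0\}$ is the customer's choice in round $s$; given the past and $(S_t,\sigma_t)$, the choice $i_t$ is drawn from $\mathbb P(\cdot\mid S_t,\sigma_t)$. Its regret is $$\mathrm{Regret}(T,\pi)=\mathbb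 E_\pi\Bigl[\sum_{t=1}^{T}\Bigl(\max_{(S,\sigma)}R(S,\sigma)-R(S_t,\sigma_t)\Bigr)\Bigr],$$ the maximum being over all feasible decisions. **Theorem.** There is an absolute constant $\eta\ge 10^{-3}$, namely $\eta=\frac{4}{675\sqrt3}$, such that for all $N,K,T$ with $K\le N/4$ and $T\ge\frac{4}{243}KN$ and for every admissible policy $\pi$, there is an instance of the general position-effects model on which $$\mathrm{Regret}(T,\pi)\ \ge\ \eta\sqrt{KNT}.$$ -/

import Mathlib

namespace PositionMNL

/-- A feasible decision `(S, σ)`: an assortment `S` of products together with an injective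
placement `σ : S → [K]`. Injectivity forces `|S| ≤ K`, see `Decision.card_le`. -/
abbrev Decision (N K : ℕ) : Type := Σ S : Finset (Fin N), (S ↪ Fin K)

theorem Decision.card_le {N K : ℕ} (d : Decision N K) : d.1.card ≤ K := by
  simpa using Fintype.card_le_of_embedding d.2

instance (N K : ℕ) : Nonempty (Decision N K) :=
  ⟨⟨∅, ⟨fun i => absurd i.2 (Finset.notMem_empty _), fun i => absurd i.2 (Finset.notMem_empty _)⟩⟩⟩

/-- An instance of the general position effects model: a revenue `r i ∈ [0, 1]` for every product
and an attraction `v i k ∈ (0, 1]` for every product-position pair. -/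
structure Instance (N K : ℕ) where
  r : Fin N → ℝ
  r_nonneg : ∀ i, 0 ≤ r i
  r_le_one : ∀ i, r i ≤ 1
  v : Fin N → Fin K → ℝ
  v_pos : ∀ i k, 0 < v i k
  v_le_one : ∀ i k, v i k ≤ 1

/-- The outcome of a round: `some i` is the purchase of product `i`, and `none` is the outside
option. -/
abbrev Outcome (N : ℕ) : Type := Option (Fin N)

namespace Instance

variable {N K : ℕ} (I : Instance N K)

/-- The total weight `1 + ∑_{j ∈ S} v_{j, σ(j)}`. -/
noncomputable def denom (d : Decision N K) : ℝ := 1 + ∑ j : d.1, I.v j (d.2 j)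

/-- The multinomial logit choice probabilities `ℙ(i | S, σ)`; a product that is not displayed is
never bought. -/
noncomputable def choiceProb (d : Decision N K) : Outcome N → ℝ
  | none => 1 / I.denom d
  | some i => if h : i ∈ d.1 then I.v i (d.2 ⟨i, h⟩) / I.denom d else 0

theorem denom_pos (d : Decision N K) : 0 < I.denom d := by
  have : 0 ≤ ∑ j : d.1, I.v j (d.2 j) := Finset.sum_nonneg fun j _ => (I.v_pos _ _).le
  unfold denom
  linarith

theorem choiceProb_nonneg (d : Decision N K) (o : Outcome N) : 0 ≤ I.choiceProb d o := by
  have hd := (I.denom_pos d).le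
  cases o with
  | none => exact div_nonneg zero_le_one hd
  | some i =>
    simp only [choiceProb]
    split_ifs with h
    · exact div_nonneg (I.v_pos _ _).le hd
    · exact le_rfl

theorem sum_choiceProb (d : Decision N K) : ∑ o, I.choiceProb d o = 1 := by
  have h1 : ∑ i : Fin N, I.choiceProb d (some i) = ∑ j : d.1, I.v j (d.2 j) / I.denom d := by
    rw [← Finset.sum_subset (Finset.subset_univ d.1), ← Finset.sum_coe_sort d.1]
    · refine Finset.sum_congr rfl fun j _ => ?_
      simp [choiceProb]
    · intro i _ hi
      simp [choiceProb, hi]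
  rw [Fintype.sum_option, h1, ← Finset.sum_div]
  change 1 / I.denom d + _ = 1
  rw [← add_div]
  exact div_self (I.denom_pos d).ne'

/-- The law of the customer's choice when the decision `d` is displayed. -/
noncomputable def choiceLaw (d : Decision N K) : PMF (Outcome N) :=
  PMF.ofFintype (fun o => ENNReal.ofReal (I.choiceProb d o)) (by
    rw [← ENNReal.ofReal_sum_of_nonneg fun o _ => I.choiceProb_nonneg d o, I.sum_choiceProb d,
      ENNReal.ofReal_one])

/-- The expected revenue `R(S, σ) = ∑_{i ∈ S} r_i ℙ(i | S, σ)`. -/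
noncomputable def revenue (d : Decision N K) : ℝ :=
  ∑ i ∈ d.1, I.r i * I.choiceProb d (some i)

/-- The maximal expected revenue over all feasible decisions. -/
noncomputable def optRevenue : ℝ :=
  (Finset.univ : Finset (Decision N K)).sup' Finset.univ_nonempty I.revenue

end Instance

/-- The observations `(S_s, σ_s, i_s)` of the first `t` rounds. -/
abbrev History (N K t : ℕ) : Type := Fin t → Decision N K × Outcome N

/-- An admissible (possibly randomized) policy: given the past observations of the first `t` rounds,
it draws the feasible decision of the next round. The revenues are known to the platform, so the
rule may also depend on them; it does not see the attractions. -/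
structure Policy (N K : ℕ) where
  rule : (Fin N → ℝ) → (t : ℕ) → History N K t → PMF (Decision N K)

/-- The law of the observations of the first `t` rounds when policy `π` is run on instance `I`. -/
noncomputable def historyLaw {N K : ℕ} (π : Policy N K) (I : Instance N K) :
    (t : ℕ) → PMF (History N K t)
  | 0 => PMF.pure Fin.elim0
  | t + 1 => (historyLaw π I t).bind fun h =>
      (π.rule I.r t h).bind fun d =>
        (I.choiceLaw d).map fun o => Fin.snoc (α := fun _ => Decision N K × Outcome N) h (d, o)

/-- The expected cumulative regret of `π` on the instance `I` over the horizon `T`. -/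
noncomputable def regret {N K : ℕ} (π : Policy N K) (I : Instance N K) (T : ℕ) : ℝ :=
  ∑ h : History N K T,
    (historyLaw π I T h).toReal * ∑ t : Fin T, (I.optRevenue - I.revenue (h t).1)

end PositionMNL

namespace PositionMNL

variable {N K : ℕ}

/-! All revenues are 1 and every attraction is a small `lo`, except that a hidden injection `e : Fin
K ↪ Fin N` raises the attraction of `e k` in position `k` to `lo * (1 + δ)`. Revenue is then 1 minus
the inverse of the total weight, so each round loses at least a multiple of `lo * δ` for every
position not filled by its hidden product.

To bound the correct placements at `k`, compare with the baseline where the raise at `k` is removed.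
The relative entropy from the baseline to the true history law is at most `lo * δ ^ 2 / 2` times the
baseline expected number of displays of `e k` in `k` (`choiceKL_spike_le`, `historyKL_le`), and a
Pinsker-type inequality transfers the display count (`sum_mass_mul_le`).

Embeddings that agree off `k` share this baseline, and under it the displays of all candidates in
position `k` total at most `T`. There are at least `N - K + 1` candidates, so on average over `e`
each position is right in at most `5/8` of the rounds (`sum_expCount_embedding_le`). Some `e`
therefore misses at least `3/8` of all placements; `δ` of order `√(K N / T)` and `lo` of order `1 /
K` give the rate. -/

/-! ### Probabilities of histories -/

theorem sum_history_succ {t : ℕ} (f : History N K (t + 1) → ℝ) :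
    ∑ h, f h = ∑ h : History N K t, ∑ d, ∑ o,
      f (Fin.snoc (α := fun _ => Decision N K × Outcome N) h (d, o)) := by
  rw [← (Fin.snocEquiv fun _ : Fin (t + 1) => Decision N K × Outcome N).sum_comp,
    Fintype.sum_prod_type_right]
  refine Finset.sum_congr rfl fun h _ => ?_
  rw [Fintype.sum_prod_type]
  rfl

/-- The real-valued probability of a history. -/
noncomputable def mass (π : Policy N K) (I : Instance N K) (t : ℕ) (h : History N K t) : ℝ :=
  (historyLaw π I t h).toReal

theorem mass_nonneg (π : Policy N K) (I : Instance N K) (t : ℕ) (h : History N K t) :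
    0 ≤ mass π I t h := ENNReal.toReal_nonneg

theorem sum_toReal_pmf {α : Type*} [Fintype α] (p : PMF α) : ∑ a, (p a).toReal = 1 := by
  rw [← ENNReal.toReal_sum fun a _ => p.apply_ne_top a, ← tsum_fintype (L := .unconditional α),
    p.tsum_coe, ENNReal.toReal_one]

theorem sum_mass (π : Policy N K) (I : Instance N K) (t : ℕ) : ∑ h, mass π I t h = 1 :=
  sum_toReal_pmf _

theorem mass_snoc (π : Policy N K) (I : Instance N K) (t : ℕ) (h : History N K t)
    (d : Decision N K) (o : Outcome N) :
    mass π I (t + 1) (Fin.snoc (α := fun _ => Decision N K × Outcome N) h (d, o)) =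
      mass π I t h * (π.rule I.r t h d).toReal * I.choiceProb d o := by
  classical
  have hinj : ∀ (h' : History N K t) (d' : Decision N K) (o' : Outcome N),
      (Fin.snoc (α := fun _ => Decision N K × Outcome N) h (d, o) : History N K (t + 1)) =
        Fin.snoc (α := fun _ => Decision N K × Outcome N) h' (d', o') ↔
        h = h' ∧ d = d' ∧ o = o' := by
    intro h' d' o'
    rw [Fin.snoc_inj, Prod.mk.injEq]
  unfold mass
  rw [historyLaw, PMF.bind_apply, tsum_fintype, Finset.sum_eq_single h]
  · rw [PMF.bind_apply, tsum_fintype, Finset.sum_eq_single d]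
    · rw [PMF.map_apply, tsum_fintype, Finset.sum_eq_single o]
      · simp [Instance.choiceLaw, ENNReal.toReal_mul,
          ENNReal.toReal_ofReal (I.choiceProb_nonneg d o), mul_assoc]
      · intro o' _ ho
        rw [if_neg]
        rw [hinj]
        exact fun hh => ho hh.2.2.symm
      · simp
    · intro d' _ hd
      rw [PMF.map_apply, tsum_fintype, Finset.sum_eq_zero, mul_zero]
      intro o' _
      rw [if_neg]
      rw [hinj]
      exact fun hh => hd hh.2.1.symm
    · simp
  · intro h' _ hh
    rw [PMF.bind_apply, tsum_fintype, Finset.sum_eq_zero, mul_zero]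
    intro d' _
    rw [PMF.map_apply, tsum_fintype, Finset.sum_eq_zero, mul_zero]
    intro o' _
    rw [if_neg]
    rw [hinj]
    exact fun h3 => hh h3.1.symm
  · simp

theorem Instance.revenue_le_optRevenue (I : Instance N K) (d : Decision N K) :
    I.revenue d ≤ I.optRevenue :=
  Finset.le_sup' I.revenue (Finset.mem_univ d)

theorem regret_nonneg (π : Policy N K) (I : Instance N K) (T : ℕ) : 0 ≤ regret π I T :=
  Finset.sum_nonneg fun _ _ => mul_nonneg ENNReal.toReal_nonneg
    (Finset.sum_nonneg fun _ _ => sub_nonneg.2 (I.revenue_le_optRevenue _))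

/-! ### Relative entropy of choices and of histories -/

/-- The relative entropy of the history laws of two instances. -/
noncomputable def historyKL (π : Policy N K) (I J : Instance N K) (t : ℕ) : ℝ :=
  ∑ h, mass π I t h * Real.log (mass π I t h / mass π J t h)

/-- The relative entropy of the choice laws of two instances. -/
noncomputable def choiceKL (I J : Instance N K) (d : Decision N K) : ℝ :=
  ∑ o, I.choiceProb d o * Real.log (I.choiceProb d o / J.choiceProb d o)

theorem Instance.choiceProb_eq_zero_iff (I J : Instance N K) (d : Decision N K) (o : Outcome N) :
    I.choiceProb d o = 0 ↔ J.choiceProb d o = 0 := by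
  have hI := (I.denom_pos d).ne'
  have hJ := (J.denom_pos d).ne'
  cases o with
  | none => simp [choiceProb, hI, hJ]
  | some i =>
    by_cases h : i ∈ d.1
    · simp [choiceProb, h, hI, hJ, (I.v_pos _ _).ne', (J.v_pos _ _).ne']
    · simp [choiceProb, h]

theorem Decision.sum_outcome (d : Decision N K) (f : Outcome N → ℝ)
    (hf : ∀ i ∉ d.1, f (some i) = 0) : ∑ o, f o = f none + ∑ j : d.1, f (some j) := by
  rw [Fintype.sum_option, Finset.sum_coe_sort d.1 fun j => f (some j),
    Finset.sum_subset (Finset.subset_univ d.1)]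
  exact fun i _ hi => hf i hi

/-- Bounding the log-ratio of the two normalizers by `log x ≤ x - 1` splits the entropy into one
term per displayed product, which vanishes wherever the two attractions agree. -/
theorem choiceKL_le (I J : Instance N K) (d : Decision N K) :
    choiceKL I J d ≤ ∑ j : d.1, (J.v j (d.2 j) - I.v j (d.2 j) -
      I.v j (d.2 j) * Real.log (J.v j (d.2 j) / I.v j (d.2 j))) / I.denom d := by
  have hI := I.denom_pos d
  have hJ := J.denom_pos d
  have h1 : choiceKL I J d = Real.log (J.denom d / I.denom d) +
      ∑ j : d.1, -(I.v j (d.2 j) * Real.log (J.v j (d.2 j) / I.v j (d.2 j))) / I.denom d := by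
    have h2 : ∀ o, I.choiceProb d o * Real.log (I.choiceProb d o / J.choiceProb d o) =
        I.choiceProb d o * Real.log (J.denom d / I.denom d) +
        I.choiceProb d o * (Real.log (I.choiceProb d o / J.choiceProb d o) -
          Real.log (J.denom d / I.denom d)) := fun o => by ring
    unfold choiceKL
    rw [Finset.sum_congr rfl fun o _ => h2 o, Finset.sum_add_distrib, ← Finset.sum_mul,
      I.sum_choiceProb, one_mul, d.sum_outcome]
    · congr 1
      have h0 : Real.log (I.choiceProb d none / J.choiceProb d none) =
          Real.log (J.denom d / I.denom d) := by
        congr 1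
        simp only [Instance.choiceProb]
        field_simp
      rw [h0, sub_self, mul_zero, zero_add]
      refine Finset.sum_congr rfl fun j _ => ?_
      have hvI := I.v_pos j (d.2 j)
      have hvJ := J.v_pos j (d.2 j)
      simp only [Instance.choiceProb, j.2, dif_pos]
      rw [Real.log_div (by positivity) (by positivity), Real.log_div hvI.ne' hI.ne',
        Real.log_div hvJ.ne' hJ.ne', Real.log_div hJ.ne' hI.ne', Real.log_div hvJ.ne' hvI.ne']
      ring
    · intro i hi
      simp [Instance.choiceProb, hi]
  have h3 : Real.log (J.denom d / I.denom d) ≤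
      ∑ j : d.1, (J.v j (d.2 j) - I.v j (d.2 j)) / I.denom d := by
    refine (Real.log_le_sub_one_of_pos (div_pos hJ hI)).trans (le_of_eq ?_)
    rw [← Finset.sum_div, Finset.sum_sub_distrib, eq_div_iff hI.ne', sub_mul,
      div_mul_cancel₀ _ hI.ne']
    simp only [Instance.denom]
    ring
  rw [h1]
  refine (add_le_add_left h3 _).trans (le_of_eq ?_)
  rw [← Finset.sum_add_distrib]
  refine Finset.sum_congr rfl fun j _ => ?_
  ring

/-- Attractions are positive, so the two laws have the same support. Hence the conventions for
division by zero and `log 0` never distort the entropy. -/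
theorem mass_eq_zero_iff (π : Policy N K) (I J : Instance N K) (hr : I.r = J.r) (t : ℕ)
    (h : History N K t) : mass π I t h = 0 ↔ mass π J t h = 0 := by
  induction t with
  | zero => rfl
  | succ t ih =>
    obtain ⟨⟨⟨d, o⟩, h'⟩, rfl⟩ :=
      (Fin.snocEquiv fun _ : Fin (t + 1) => Decision N K × Outcome N).surjective h
    change mass π I (t + 1) (Fin.snoc (α := fun _ => Decision N K × Outcome N) h' (d, o)) = 0 ↔
      mass π J (t + 1) (Fin.snoc (α := fun _ => Decision N K × Outcome N) h' (d, o)) = 0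
    rw [mass_snoc, mass_snoc, mul_eq_zero, mul_eq_zero, mul_eq_zero, mul_eq_zero, ih h', hr,
      I.choiceProb_eq_zero_iff J]

/-- If a statistic of a single decision dominates the relative entropy of the choice laws, its
cumulative expectation dominates the relative entropy of the history laws. -/
theorem historyKL_le (π : Policy N K) (I J : Instance N K) (hr : I.r = J.r)
    (g : Decision N K → ℝ) (hg : ∀ d, choiceKL I J d ≤ g d) (T : ℕ) :
    historyKL π I J T ≤ ∑ h, mass π I T h * ∑ t, g (h t).1 := by
  induction T with
  | zero =>
    simp [historyKL, mass, historyLaw]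
  | succ T ih =>
    unfold historyKL at ih ⊢
    rw [sum_history_succ, sum_history_succ]
    have key : ∀ (h : History N K T) (a : ℝ) (b : Decision N K → ℝ),
        ∑ d, ∑ o, mass π I T h * (π.rule I.r T h d).toReal * I.choiceProb d o * (a + b d) =
          mass π I T h * a + mass π I T h * ∑ d, (π.rule I.r T h d).toReal * b d := by
      intro h a b
      have e1 : ∀ d, ∑ o, mass π I T h * (π.rule I.r T h d).toReal * I.choiceProb d o * (a + b d)
          = (π.rule I.r T h d).toReal * (mass π I T h * a) +
            mass π I T h * ((π.rule I.r T h d).toReal * b d) := by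
        intro d
        rw [← Finset.sum_mul, ← Finset.mul_sum, I.sum_choiceProb]
        ring
      rw [Finset.sum_congr rfl fun d _ => e1 d, Finset.sum_add_distrib, ← Finset.sum_mul,
        sum_toReal_pmf, one_mul, Finset.mul_sum]
    have hl : ∀ h : History N K T, ∑ d, ∑ o,
        mass π I (T + 1) (Fin.snoc (α := fun _ => Decision N K × Outcome N) h (d, o)) *
          Real.log (mass π I (T + 1) (Fin.snoc (α := fun _ => Decision N K × Outcome N) h (d, o)) /
            mass π J (T + 1) (Fin.snoc (α := fun _ => Decision N K × Outcome N) h (d, o))) =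
        mass π I T h * Real.log (mass π I T h / mass π J T h) +
          mass π I T h * ∑ d, (π.rule I.r T h d).toReal * choiceKL I J d := by
      intro h
      rw [← key]
      refine Finset.sum_congr rfl fun d _ => ?_
      have e2 : ∀ o,
          mass π I (T + 1) (Fin.snoc (α := fun _ => Decision N K × Outcome N) h (d, o)) *
          Real.log (mass π I (T + 1) (Fin.snoc (α := fun _ => Decision N K × Outcome N) h (d, o)) /
            mass π J (T + 1) (Fin.snoc (α := fun _ => Decision N K × Outcome N) h (d, o))) =
          mass π I T h * (π.rule I.r T h d).toReal * I.choiceProb d o *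
              Real.log (mass π I T h / mass π J T h) +
            mass π I T h * (π.rule I.r T h d).toReal *
              (I.choiceProb d o * Real.log (I.choiceProb d o / J.choiceProb d o)) := by
        -- The policy sees the same revenues under both instances, so its factor cancels in the
        -- likelihood ratio.
        intro o
        rw [mass_snoc, mass_snoc, ← hr]
        by_cases h1 : mass π I T h = 0
        · simp [h1]
        by_cases h2 : (π.rule I.r T h d).toReal = 0
        · simp [h2]
        by_cases h3 : I.choiceProb d o = 0
        · simp [h3]
        have h4 := mt (mass_eq_zero_iff π I J hr T h).2 h1
        have h5 := mt (I.choiceProb_eq_zero_iff J d o).2 h3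
        have e3 : mass π I T h * (π.rule I.r T h d).toReal * I.choiceProb d o /
            (mass π J T h * (π.rule I.r T h d).toReal * J.choiceProb d o) =
            (mass π I T h / mass π J T h) * (I.choiceProb d o / J.choiceProb d o) := by
          field_simp
        rw [e3, Real.log_mul (div_ne_zero h1 h4) (div_ne_zero h3 h5)]
        ring
      rw [Finset.sum_congr rfl fun o _ => e2 o, Finset.sum_add_distrib, ← Finset.mul_sum,
        ← Finset.sum_mul, ← Finset.sum_mul, ← Finset.mul_sum, I.sum_choiceProb]
      change _ + _ * choiceKL I J d = _
      ring
    have hrr : ∀ h : History N K T, ∑ d, ∑ o,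
        mass π I (T + 1) (Fin.snoc (α := fun _ => Decision N K × Outcome N) h (d, o)) *
          ∑ t, g ((Fin.snoc (α := fun _ => Decision N K × Outcome N) h (d, o) :
            History N K (T + 1)) t).1 =
        mass π I T h * ∑ t, g (h t).1 +
          mass π I T h * ∑ d, (π.rule I.r T h d).toReal * g d := by
      intro h
      rw [← key]
      refine Finset.sum_congr rfl fun d _ => Finset.sum_congr rfl fun o _ => ?_
      rw [mass_snoc, Fin.sum_univ_castSucc]
      simp only [Fin.snoc_castSucc, Fin.snoc_last]
    rw [Finset.sum_congr rfl fun h _ => hl h, Finset.sum_congr rfl fun h _ => hrr h,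
      Finset.sum_add_distrib, Finset.sum_add_distrib]
    refine add_le_add ih (Finset.sum_le_sum fun h _ => ?_)
    exact mul_le_mul_of_nonneg_left (Finset.sum_le_sum fun d _ =>
      mul_le_mul_of_nonneg_left (hg d) ENNReal.toReal_nonneg) (mass_nonneg _ _ _ _)

/-! ### Change of measure -/

/-- A pointwise Pinsker inequality: the entropy term dominates `(√p - √q) ^ 2`, and `|p - q| = |√p -
√q| * (√p + √q)` is split by AM-GM. The free weight `s` replaces the square root, keeping the bound
linear in the entropy so that it can be averaged later. -/
theorem abs_sub_le_entropy {p q s : ℝ} (hp : 0 ≤ p) (hq : 0 ≤ q) (hpq : p = 0 ↔ q = 0)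
    (hs : 0 < s) :
    |p - q| ≤ (p * Real.log (p / q) - p + q) / (2 * s) + s * (p + q) := by
  rcases hp.eq_or_lt with rfl | hp
  · simp [hpq.1 rfl]
  have hq' : 0 < q := lt_of_le_of_ne hq fun h => hp.ne' (hpq.2 h.symm)
  obtain ⟨x, hx, rfl⟩ : ∃ x : ℝ, 0 < x ∧ x ^ 2 = p := ⟨√p, Real.sqrt_pos.2 hp, Real.sq_sqrt hp.le⟩
  obtain ⟨y, hy, rfl⟩ : ∃ y : ℝ, 0 < y ∧ y ^ 2 = q := ⟨√q, Real.sqrt_pos.2 hq', Real.sq_sqrt hq⟩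
  have hlog : (x - y) ^ 2 ≤ x ^ 2 * Real.log (x ^ 2 / y ^ 2) - x ^ 2 + y ^ 2 := by
    have h1 := Real.log_le_sub_one_of_pos (div_pos hy hx)
    have h2 : Real.log (x ^ 2 / y ^ 2) = -2 * Real.log (y / x) := by
      rw [← div_pow, Real.log_pow, ← inv_div y x, Real.log_inv]
      push_cast
      ring
    have h3 : x ^ 2 * Real.log (y / x) ≤ x ^ 2 * (y / x - 1) :=
      mul_le_mul_of_nonneg_left h1 (by positivity)
    have h4 : x ^ 2 * (y / x - 1) = x * y - x ^ 2 := by field_simp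
    rw [h2]
    nlinarith
  have h5 : |x ^ 2 - y ^ 2| ≤ (x - y) ^ 2 / (2 * s) + s * (x ^ 2 + y ^ 2) := by
    have h6 : |x ^ 2 - y ^ 2| = |x - y| * (x + y) := by
      rw [← abs_of_pos (add_pos hx hy), ← abs_mul]
      congr 1
      ring
    rw [h6, ← sub_nonneg]
    have h7 : (x - y) ^ 2 / (2 * s) + s * (x ^ 2 + y ^ 2) - |x - y| * (x + y) =
        ((|x - y| - s * (x + y)) ^ 2 + s ^ 2 * (x - y) ^ 2) / (2 * s) := by
      have hw := sq_abs (x - y)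
      field_simp
      linear_combination -hw
    rw [h7]
    positivity
  refine h5.trans (add_le_add_left ?_ _)
  gcongr

/-- Change of measure for a bounded statistic of the history. -/
theorem sum_mass_mul_le (π : Policy N K) (I J : Instance N K) (hr : I.r = J.r) (T : ℕ)
    (F : History N K T → ℝ) {B s : ℝ} (hF0 : ∀ h, 0 ≤ F h) (hFB : ∀ h, F h ≤ B) (hs : 0 < s) :
    ∑ h, mass π J T h * F h ≤
      ∑ h, mass π I T h * F h + B * (historyKL π I J T / (4 * s) + s) := by
  have hB : 0 ≤ B := by
    obtain ⟨h, _⟩ := (historyLaw π I T).support_nonempty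
    exact (hF0 h).trans (hFB h)
  -- Both masses total 1, so `F` may be centred at `B / 2`; this halves its sup norm.
  have h1 : ∑ h, mass π J T h * F h - ∑ h, mass π I T h * F h =
      ∑ h, (mass π J T h - mass π I T h) * (F h - B / 2) := by
    have : ∑ h, (mass π J T h - mass π I T h) * (B / 2) = 0 := by
      rw [← Finset.sum_mul, Finset.sum_sub_distrib, sum_mass, sum_mass, sub_self, zero_mul]
    rw [← sub_zero (∑ h, mass π J T h * F h - ∑ h, mass π I T h * F h), ← this,
      ← Finset.sum_sub_distrib, ← Finset.sum_sub_distrib]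
    exact Finset.sum_congr rfl fun h _ => by ring
  have h2 : ∑ h, (mass π J T h - mass π I T h) * (F h - B / 2) ≤
      ∑ h, ((mass π I T h * Real.log (mass π I T h / mass π J T h) - mass π I T h + mass π J T h) /
        (2 * s) + s * (mass π I T h + mass π J T h)) * (B / 2) := by
    refine Finset.sum_le_sum fun h _ => ?_
    refine (le_abs_self _).trans ?_
    rw [abs_mul, abs_sub_comm]
    refine mul_le_mul (abs_sub_le_entropy (mass_nonneg _ _ _ _) (mass_nonneg _ _ _ _)
      (mass_eq_zero_iff π I J hr T h) hs) ?_ (abs_nonneg _)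
      ((abs_nonneg _).trans (abs_sub_le_entropy (mass_nonneg _ _ _ _) (mass_nonneg _ _ _ _)
      (mass_eq_zero_iff π I J hr T h) hs))
    rw [abs_le]
    constructor <;> linarith [hF0 h, hFB h]
  rw [← Finset.sum_mul, Finset.sum_add_distrib, ← Finset.sum_div, Finset.sum_add_distrib,
    Finset.sum_sub_distrib, ← Finset.mul_sum, Finset.sum_add_distrib, sum_mass, sum_mass] at h2
  change _ ≤ ((historyKL π I J T - 1 + 1) / (2 * s) + s * (1 + 1)) * (B / 2) at h2
  have h3 : ((historyKL π I J T - 1 + 1) / (2 * s) + s * (1 + 1)) * (B / 2) =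
      B * (historyKL π I J T / (4 * s) + s) := by
    field_simp
    ring
  linarith

/-! ### Hard instances and display counts -/

/-- The instance with unit revenues in which position `k` has the attraction `hi` for the product
`b k`, if there is one, and all other attractions are `lo`. -/
noncomputable def spike (lo hi : ℝ) (hlo : 0 < lo) (hlo' : lo ≤ 1) (hhi : 0 < hi) (hhi' : hi ≤ 1)
    (b : Fin K → Option (Fin N)) : Instance N K where
  r _ := 1
  r_nonneg _ := zero_le_one
  r_le_one _ := le_rfl
  v i k := if b k = some i then hi else lo
  v_pos i k := by split_ifs <;> assumption
  v_le_one i k := by split_ifs <;> assumption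

/-- The indicator of displaying product `i` in position `k`. -/
noncomputable def hits (d : Decision N K) (i : Fin N) (k : Fin K) : ℝ :=
  ∑ j : d.1, if (j : Fin N) = i ∧ d.2 j = k then 1 else 0

theorem hits_nonneg (d : Decision N K) (i : Fin N) (k : Fin K) : 0 ≤ hits d i k :=
  Finset.sum_nonneg fun j _ => by split_ifs <;> norm_num

theorem sum_hits_le_one (d : Decision N K) (k : Fin K) : ∑ i, hits d i k ≤ 1 := by
  unfold hits
  rw [Finset.sum_comm]
  have h1 : ∀ j : d.1, ∑ i, (if (j : Fin N) = i ∧ d.2 j = k then (1 : ℝ) else 0) =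
      if d.2 j = k then 1 else 0 := by
    intro j
    by_cases h : d.2 j = k <;> simp [h]
  rw [Finset.sum_congr rfl fun j _ => h1 j, Finset.sum_boole]
  norm_cast
  refine Finset.card_le_one.2 fun x hx y hy => d.2.injective ?_
  rw [(Finset.mem_filter.1 hx).2, (Finset.mem_filter.1 hy).2]

theorem hits_le_one (d : Decision N K) (i : Fin N) (k : Fin K) : hits d i k ≤ 1 :=
  (Finset.single_le_sum (f := fun i => hits d i k) (fun i _ => hits_nonneg d i k)
    (Finset.mem_univ i)).trans (sum_hits_le_one d k)

/-- The number of rounds in which product `i` is displayed in position `k`. -/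
noncomputable def count {T : ℕ} (i : Fin N) (k : Fin K) (h : History N K T) : ℝ :=
  ∑ t, hits (h t).1 i k

theorem count_nonneg {T : ℕ} (i : Fin N) (k : Fin K) (h : History N K T) : 0 ≤ count i k h :=
  Finset.sum_nonneg fun _ _ => hits_nonneg _ _ _

theorem count_le {T : ℕ} (i : Fin N) (k : Fin K) (h : History N K T) : count i k h ≤ T := by
  refine (Finset.sum_le_sum fun _ _ => hits_le_one _ _ _).trans ?_
  simp

theorem sum_count_le {T : ℕ} (k : Fin K) (h : History N K T) : ∑ i, count i k h ≤ T := by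
  unfold count
  rw [Finset.sum_comm]
  refine (Finset.sum_le_sum fun _ _ => sum_hits_le_one _ _).trans ?_
  simp

/-- The expected number of rounds in which product `i` is displayed in position `k`. -/
noncomputable def expCount (π : Policy N K) (I : Instance N K) (T : ℕ) (i : Fin N) (k : Fin K) :
    ℝ := ∑ h, mass π I T h * count i k h

theorem expCount_nonneg (π : Policy N K) (I : Instance N K) (T : ℕ) (i : Fin N) (k : Fin K) :
    0 ≤ expCount π I T i k :=
  Finset.sum_nonneg fun _ _ => mul_nonneg (mass_nonneg _ _ _ _) (count_nonneg _ _ _)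

theorem sum_expCount_le (π : Policy N K) (I : Instance N K) (T : ℕ) (k : Fin K) :
    ∑ i, expCount π I T i k ≤ T := by
  unfold expCount
  rw [Finset.sum_comm]
  calc ∑ h, ∑ i, mass π I T h * count i k h ≤ ∑ h, mass π I T h * T :=
        Finset.sum_le_sum fun h _ => by
          rw [← Finset.mul_sum]
          exact mul_le_mul_of_nonneg_left (sum_count_le k h) (mass_nonneg _ _ _ _)
    _ = T := by rw [← Finset.sum_mul, sum_mass, one_mul]

/-! ### Information cost of a single raised attraction -/

theorem sub_sub_mul_log_le {x δ : ℝ} (hx : 0 < x) (hδ : 0 ≤ δ) :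
    x * (1 + δ) - x - x * Real.log (x * (1 + δ) / x) ≤ x * δ ^ 2 / 2 := by
  have h1 := Real.le_log_one_add_of_nonneg hδ
  have h2 : δ - δ ^ 2 / 2 ≤ 2 * δ / (δ + 2) := by
    rw [le_div_iff₀ (by linarith)]
    nlinarith [pow_nonneg hδ 3]
  rw [mul_div_cancel_left₀ _ hx.ne']
  nlinarith [mul_le_mul_of_nonneg_left (h2.trans h1) hx.le]

variable {lo δ : ℝ} (hlo : 0 < lo) (hlo' : lo ≤ 1) (hhi : 0 < lo * (1 + δ))
  (hhi' : lo * (1 + δ) ≤ 1)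

/-- The instances differ only at the pair `(i, k)`, so a round is informative only if it displays
`i` in `k`. The entropy is taken under the baseline `b`, and its normalizer is dropped because it is
at least 1. -/
theorem choiceKL_spike_le (hδ : 0 ≤ δ) (b b' : Fin K → Option (Fin N)) (i : Fin N) (k : Fin K)
    (hb : b k = none) (hb' : b' k = some i) (hbb : ∀ l ≠ k, b' l = b l) (d : Decision N K) :
    choiceKL (spike lo _ hlo hlo' hhi hhi' b) (spike lo _ hlo hlo' hhi hhi' b') d ≤
      lo * δ ^ 2 / 2 * hits d i k := by
  refine (choiceKL_le _ _ d).trans ?_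
  unfold hits
  rw [Finset.mul_sum]
  refine Finset.sum_le_sum fun j _ => ?_
  have hden : 1 ≤ (spike lo _ hlo hlo' hhi hhi' b).denom d := by
    unfold Instance.denom
    linarith [Finset.sum_nonneg fun (j : d.1) (_ : j ∈ Finset.univ) =>
      ((spike lo _ hlo hlo' hhi hhi' b).v_pos j (d.2 j)).le]
  set D := (spike lo _ hlo hlo' hhi hhi' b).denom d
  simp only [spike]
  have hpos : 0 ≤ lo * δ ^ 2 / 2 := by positivity
  by_cases hk : d.2 j = k
  · rw [hk, hb, hb']
    by_cases hi : i = j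
    · simp only [reduceCtorEq, if_false, hi, if_true, and_self]
      rw [mul_one]
      exact (div_le_iff₀ (one_pos.trans_le hden)).2 ((sub_sub_mul_log_le hlo hδ).trans
        (le_mul_of_one_le_right hpos hden))
    · simp [hi, Ne.symm hi, hlo.ne']
  · rw [hbb _ hk]
    simp only [hk, and_false, if_false, mul_zero, sub_self, zero_sub]
    split_ifs
    · simp [hhi.ne']
    · simp [hlo.ne']

theorem expCount_spike_le (hδ : 0 ≤ δ) (π : Policy N K) (T : ℕ) (b b' : Fin K → Option (Fin N))
    (i : Fin N) (k : Fin K) (hb : b k = none) (hb' : b' k = some i) (hbb : ∀ l ≠ k, b' l = b l)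
    {s : ℝ} (hs : 0 < s) :
    expCount π (spike lo _ hlo hlo' hhi hhi' b') T i k ≤
      expCount π (spike lo _ hlo hlo' hhi hhi' b) T i k +
        T * (lo * δ ^ 2 / 2 * expCount π (spike lo _ hlo hlo' hhi hhi' b) T i k / (4 * s) + s) := by
  refine (sum_mass_mul_le π (spike lo _ hlo hlo' hhi hhi' b) (spike lo _ hlo hlo' hhi hhi' b') rfl T
    (count i k) (count_nonneg i k) (count_le i k) hs).trans ?_
  have h1 := historyKL_le π (spike lo _ hlo hlo' hhi hhi' b) (spike lo _ hlo hlo' hhi hhi' b') rfl _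
    (choiceKL_spike_le hlo hlo' hhi hhi' hδ b b' i k hb hb' hbb) T
  have h2 : ∑ h, mass π (spike lo _ hlo hlo' hhi hhi' b) T h *
      ∑ t, lo * δ ^ 2 / 2 * hits (h t).1 i k =
      lo * δ ^ 2 / 2 * expCount π (spike lo _ hlo hlo' hhi hhi' b) T i k := by
    unfold expCount count
    rw [Finset.mul_sum]
    refine Finset.sum_congr rfl fun h _ => ?_
    rw [← Finset.mul_sum]
    ring
  rw [h2] at h1
  refine add_le_add_right ?_ _
  gcongr

/-! ### Averaging over the hidden embedding -/

/-- The baseline obtained from an embedding by forgetting the product of position `k`. -/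
def forget (k : Fin K) (e : Fin K ↪ Fin N) : Fin K → Option (Fin N) :=
  Function.update (fun l => some (e l)) k none

theorem forget_eq_iff {k : Fin K} {e e' : Fin K ↪ Fin N} :
    forget k e = forget k e' ↔ ∀ l ≠ k, e l = e' l := by
  constructor
  · intro h l hl
    have := congrFun h l
    simpa [forget, hl] using this
  · intro h
    funext l
    by_cases hl : l = k
    · simp [forget, hl]
    · simp [forget, hl, h l hl]

theorem injOn_forget_fiber (k : Fin K) (b : Fin K → Option (Fin N)) :
    Set.InjOn (fun e : Fin K ↪ Fin N => e k) {e | forget k e = b} := by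
  intro e he e' he' h
  ext l
  by_cases hl : l = k
  · rw [hl]; exact congrArg _ h
  · rw [forget_eq_iff.1 ((he : forget k e = b).trans (he' : forget k e' = b).symm) l hl]

/-- Any product outside the `K - 1` used in the other positions can be put in position `k`. -/
theorem le_card_forget_fiber (k : Fin K) (e : Fin K ↪ Fin N) :
    N + 1 ≤ K + ({e' | forget k e' = forget k e} : Finset (Fin K ↪ Fin N)).card := by
  have h1 : ((Finset.univ.erase k).map e)ᶜ.card ≤
      ({e' | forget k e' = forget k e} : Finset (Fin K ↪ Fin N)).card := by
    have hsub : ((Finset.univ.erase k).map e)ᶜ ⊆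
        ({e' | forget k e' = forget k e} : Finset (Fin K ↪ Fin N)).image fun e' => e' k := by
      intro i hi
      have hi' : ∀ l ≠ k, e l ≠ i := fun l hl h => Finset.mem_compl.1 hi
        (Finset.mem_map.2 ⟨l, Finset.mem_erase.2 ⟨hl, Finset.mem_univ l⟩, h⟩)
      refine Finset.mem_image.2 ⟨⟨Function.update e k i, ?_⟩, ?_, ?_⟩
      · intro l l' h
        by_cases hl : l = k <;> by_cases hl' : l' = k
        · rw [hl, hl']
        · subst hl
          simp only [Function.update_self, Function.update_of_ne hl'] at h
          exact absurd h.symm (hi' l' hl')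
        · subst hl'
          simp only [Function.update_self, Function.update_of_ne hl] at h
          exact absurd h (hi' l hl)
        · simp only [Function.update_of_ne hl, Function.update_of_ne hl'] at h
          exact e.injective h
      · rw [Finset.mem_filter]
        refine ⟨Finset.mem_univ _, forget_eq_iff.2 fun l hl => Function.update_of_ne hl _ _⟩
      · exact Function.update_self ..
    exact (Finset.card_le_card hsub).trans Finset.card_image_le
  rw [Finset.card_compl, Finset.card_map, Finset.card_erase_of_mem (Finset.mem_univ k),
    Finset.card_fin, Fintype.card_fin] at h1
  have := k.pos
  omega

/-- Average over the hidden product of position `k`. -/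
theorem sum_fiber_expCount_le (hδ : 0 ≤ δ) (π : Policy N K) (T : ℕ) (k : Fin K)
    (e₀ : Fin K ↪ Fin N) {m : ℝ} (hm : 4 ≤ m)
    (hmc : m ≤ (({e | forget k e = forget k e₀} : Finset (Fin K ↪ Fin N)).card : ℝ))
    (hT : lo * δ ^ 2 / 2 * T ≤ 9 / 64 * m) :
    ∑ e : Fin K ↪ Fin N with forget k e = forget k e₀,
        expCount π (spike lo _ hlo hlo' hhi hhi' fun l => some (e l)) T (e k) k ≤
      ∑ e : Fin K ↪ Fin N with forget k e = forget k e₀, (5 / 8 * T : ℝ) := by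
  set A : Finset (Fin K ↪ Fin N) := {e | forget k e = forget k e₀} with hA
  set I := spike lo _ hlo hlo' hhi hhi' (forget k e₀) with hI
  have hle : ∀ e ∈ A, expCount π (spike lo _ hlo hlo' hhi hhi' fun l => some (e l)) T (e k) k ≤
      expCount π I T (e k) k * (1 + T * (lo * δ ^ 2 / 2) * (4 / 3)) + T * (3 / 16) := by
    intro e he
    have he' : forget k e = forget k e₀ := (Finset.mem_filter.1 he).2
    -- With `s = 3/16` the entropy gets the factor `1 / (4 * s) = 4/3`.
    refine (expCount_spike_le hlo hlo' hhi hhi' hδ π T (forget k e₀) _ (e k) k ?_ rfl ?_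
      (s := 3 / 16) (by norm_num)).trans (le_of_eq ?_)
    · simp [forget]
    · intro l hl
      rw [← he']
      simp [forget, hl]
    · rw [← hI]
      ring
  -- Within the fiber the products `e k` are distinct, and position `k` shows at most one product
  -- per round.
  have hsum : ∑ e ∈ A, expCount π I T (e k) k ≤ T := by
    have hinj : Set.InjOn (fun e : Fin K ↪ Fin N => e k) A := by
      have := injOn_forget_fiber k (forget k e₀)
      rwa [hA, Finset.coe_filter_univ]
    rw [← Finset.sum_image (f := fun i => expCount π I T i k) hinj]
    exact (Finset.sum_le_sum_of_subset_of_nonneg (Finset.subset_univ _)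
      fun i _ _ => expCount_nonneg π I T i k).trans (sum_expCount_le π I T k)
  refine (Finset.sum_le_sum hle).trans ?_
  rw [Finset.sum_add_distrib, ← Finset.sum_mul, Finset.sum_const, Finset.sum_const, nsmul_eq_mul,
    nsmul_eq_mul]
  have hT0 : (0 : ℝ) ≤ T := T.cast_nonneg
  have h1 : (0 : ℝ) ≤ 1 + T * (lo * δ ^ 2 / 2) * (4 / 3) := by positivity
  -- Per embedding, in units of `T`: at most `1/4` from the baseline count (as `4 ≤ m`), `4/3 * 9/64
  -- = 3/16` from the entropy, and `s = 3/16`; together `5/8`.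
  nlinarith [mul_le_mul_of_nonneg_right hsum h1, mul_le_mul_of_nonneg_left hT hT0,
    mul_le_mul_of_nonneg_left hmc hT0, mul_le_mul_of_nonneg_left hm hT0]

theorem sum_expCount_embedding_le (hδ : 0 ≤ δ) (π : Policy N K) (T : ℕ) (k : Fin K)
    (hNK : (K : ℝ) ≤ N / 4) (hT : lo * δ ^ 2 / 2 * T ≤ 27 / 256 * N) :
    ∑ e : Fin K ↪ Fin N,
        expCount π (spike lo _ hlo hlo' hhi hhi' fun l => some (e l)) T (e k) k ≤
      ∑ _e : Fin K ↪ Fin N, (5 / 8 * T : ℝ) := by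
  classical
  have hK : (1 : ℝ) ≤ K := by exact_mod_cast k.pos
  rw [← Finset.sum_fiberwise_of_maps_to (s := Finset.univ) (t := Finset.univ.image (forget k))
      (g := forget k) (fun e he => Finset.mem_image_of_mem _ he),
    ← Finset.sum_fiberwise_of_maps_to (s := Finset.univ) (t := Finset.univ.image (forget k))
      (g := forget k) (fun e he => Finset.mem_image_of_mem _ he) (fun _ => (5 / 8 * T : ℝ))]
  refine Finset.sum_le_sum fun b hb => ?_
  obtain ⟨e₀, -, rfl⟩ := Finset.mem_image.1 hb
  have hcard : (N : ℝ) + 1 ≤ K +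
      (({e | forget k e = forget k e₀} : Finset (Fin K ↪ Fin N)).card : ℝ) := by
    exact_mod_cast le_card_forget_fiber k e₀
  -- The fiber has at least `N - K + 1 ≥ 3/4 * N + 1` elements, and `N ≥ 4 * K ≥ 4`. Also `27/256 =
  -- 9/64 * 3/4`.
  exact sum_fiber_expCount_le hlo hlo' hhi hhi' hδ π T k e₀ (m := 3 / 4 * N + 1) (by linarith)
    (by linarith) (by linarith)

/-! ### From misplacements to regret -/

theorem revenue_spike (b : Fin K → Option (Fin N)) (d : Decision N K) :
    (spike lo _ hlo hlo' hhi hhi' b).revenue d =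
      1 - 1 / (spike lo _ hlo hlo' hhi hhi' b).denom d := by
  set I := spike lo _ hlo hlo' hhi hhi' b with hI
  have h1 := I.sum_choiceProb d
  rw [d.sum_outcome _ fun i hi => by simp [Instance.choiceProb, hi],
    Finset.sum_coe_sort d.1 fun j => I.choiceProb d (some j)] at h1
  have h2 : I.revenue d = ∑ j ∈ d.1, I.choiceProb d (some j) :=
    Finset.sum_congr rfl fun j _ => one_mul _
  rw [h2]
  exact eq_sub_of_add_eq' h1

theorem denom_spike (e : Fin K ↪ Fin N) (d : Decision N K) :
    (spike lo _ hlo hlo' hhi hhi' fun l => some (e l)).denom d =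
      1 + lo * d.1.card + lo * δ * ∑ k, hits d (e k) k := by
  have h1 : ∑ k, hits d (e k) k = ∑ j : d.1, if e (d.2 j) = j then (1 : ℝ) else 0 := by
    unfold hits
    rw [Finset.sum_comm]
    refine Finset.sum_congr rfl fun j _ => ?_
    rw [Finset.sum_eq_single (d.2 j)]
    · simp [eq_comm]
    · intro k _ hk
      simp [Ne.symm hk]
    · simp
  rw [h1, Finset.mul_sum, Instance.denom, add_assoc]
  congr 1
  have h2 : lo * d.1.card = ∑ _j : d.1, lo := by simp [mul_comm]
  rw [h2, ← Finset.sum_add_distrib]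
  refine Finset.sum_congr rfl fun j _ => ?_
  by_cases h : e (d.2 j) = j
  · simp [spike, h]; ring
  · simp [spike, h]

theorem exists_full_decision (e : Fin K ↪ Fin N) :
    ∃ d : Decision N K, d.1.card = K ∧ ∀ k, hits d (e k) k = 1 := by
  have hex : ∀ x : (Finset.univ.map e : Finset (Fin N)), ∃ k, e k = x := fun x => by
    obtain ⟨k, -, hk⟩ := Finset.mem_map.1 x.2
    exact ⟨k, hk⟩
  choose f hf using hex
  have hinj : Function.Injective f := fun x y h => Subtype.ext (by rw [← hf x, ← hf y, h])
  refine ⟨⟨Finset.univ.map e, ⟨f, hinj⟩⟩, by simp, fun k => ?_⟩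
  unfold hits
  have hmem : e k ∈ (Finset.univ.map e : Finset (Fin N)) := by simp
  have hfk : f ⟨e k, hmem⟩ = k := e.injective (hf _)
  rw [Finset.sum_eq_single ⟨e k, hmem⟩]
  · simp [hfk]
  · intro j _ hj
    rw [if_neg]
    exact fun h => hj (Subtype.ext h.1)
  · simp

/-- The hidden placement has total weight `x`, exceeding the weight `y` of `d` by at least `lo * δ`
per missed position. The revenue gap is `(x - y) / (x * y)`, and both weights are at most `D`. -/
theorem le_optRevenue_sub_revenue (hδ : 0 ≤ δ) {D : ℝ} (hD : 1 + lo * (1 + δ) * K ≤ D)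
    (e : Fin K ↪ Fin N) (d : Decision N K) :
    lo * δ / D ^ 2 * (K - ∑ k, hits d (e k) k) ≤
      (spike lo _ hlo hlo' hhi hhi' fun l => some (e l)).optRevenue -
        (spike lo _ hlo hlo' hhi hhi' fun l => some (e l)).revenue d := by
  obtain ⟨d', hc, hh⟩ := exists_full_decision e
  have hD' := denom_spike hlo hlo' hhi hhi' e d'
  have hDd := denom_spike hlo hlo' hhi hhi' e d
  have hopt := (spike lo _ hlo hlo' hhi hhi' fun l => some (e l)).revenue_le_optRevenue d'
  have hp' := (spike lo _ hlo hlo' hhi hhi' fun l => some (e l)).denom_pos d'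
  have hp := (spike lo _ hlo hlo' hhi hhi' fun l => some (e l)).denom_pos d
  rw [revenue_spike] at hopt ⊢
  set x := (spike lo _ hlo hlo' hhi hhi' fun l => some (e l)).denom d'
  set y := (spike lo _ hlo hlo' hhi hhi' fun l => some (e l)).denom d
  have hH : ∑ k, hits d (e k) k ≤ K :=
    (Finset.sum_le_sum fun k _ => hits_le_one d (e k) k).trans (by simp)
  have hcard : (d.1.card : ℝ) ≤ K := by exact_mod_cast d.card_le
  simp only [hh, Finset.sum_const, Finset.card_fin, nsmul_eq_mul, mul_one, hc] at hD'
  have hlδ : 0 ≤ lo * δ := by positivity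
  have hxy : lo * δ * (K - ∑ k, hits d (e k) k) ≤ x - y := by
    rw [hD', hDd]
    nlinarith [mul_le_mul_of_nonneg_left hcard hlo.le]
  have hn : 0 ≤ lo * δ * (K - ∑ k, hits d (e k) k) := mul_nonneg hlδ (by linarith)
  have hxD : x ≤ D := by rw [hD']; linarith
  have hyD : y ≤ D := by linarith
  calc lo * δ / D ^ 2 * (K - ∑ k, hits d (e k) k)
      = lo * δ * (K - ∑ k, hits d (e k) k) / D ^ 2 := by ring
    _ ≤ (x - y) / (x * y) := by
        refine div_le_div₀ (hn.trans hxy) hxy (by positivity) ?_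
        rw [sq]
        exact mul_le_mul hxD hyD hp.le (by linarith)
    _ = (1 - 1 / x) - (1 - 1 / y) := by
        field_simp
        ring
    _ ≤ _ := by linarith

theorem le_regret_spike (hδ : 0 ≤ δ) {D : ℝ} (hD : 1 + lo * (1 + δ) * K ≤ D)
    (e : Fin K ↪ Fin N) (π : Policy N K) (T : ℕ) :
    lo * δ / D ^ 2 * (K * T -
        ∑ k, expCount π (spike lo _ hlo hlo' hhi hhi' fun l => some (e l)) T (e k) k) ≤
      regret π (spike lo _ hlo hlo' hhi hhi' fun l => some (e l)) T := by
  set I := spike lo _ hlo hlo' hhi hhi' fun l => some (e l)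
  have h1 : K * T - ∑ k, expCount π I T (e k) k =
      ∑ h, mass π I T h * ∑ t, (K - ∑ k, hits (h t).1 (e k) k) := by
    have h2 : ∀ h : History N K T, mass π I T h * ∑ t, ((K : ℝ) - ∑ k, hits (h t).1 (e k) k) =
        mass π I T h * (K * T) - ∑ k, mass π I T h * count (e k) k h := by
      intro h
      unfold count
      rw [← Finset.mul_sum, ← mul_sub, Finset.sum_sub_distrib, Finset.sum_comm]
      simp [mul_comm]
    rw [Finset.sum_congr rfl fun h _ => h2 h, Finset.sum_sub_distrib, ← Finset.sum_mul, sum_mass,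
      one_mul, Finset.sum_comm]
    rfl
  rw [h1, Finset.mul_sum]
  refine Finset.sum_le_sum fun h _ => ?_
  rw [mul_left_comm, Finset.mul_sum]
  exact mul_le_mul_of_nonneg_left (Finset.sum_le_sum fun t _ =>
    le_optRevenue_sub_revenue hlo hlo' hhi hhi' hδ hD e _) (mass_nonneg _ _ _ _)

theorem exists_le_regret_spike (hδ : 0 ≤ δ) {D : ℝ} (hD : 1 + lo * (1 + δ) * K ≤ D)
    (π : Policy N K) (T : ℕ) (hNK : (K : ℝ) ≤ N / 4) (hT : lo * δ ^ 2 / 2 * T ≤ 27 / 256 * N) :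
    ∃ e : Fin K ↪ Fin N, lo * δ / D ^ 2 * (3 / 8 * (K * T)) ≤
      regret π (spike lo _ hlo hlo' hhi hhi' fun l => some (e l)) T := by
  have hKN : K ≤ N := by
    have : (K : ℝ) ≤ N := hNK.trans (div_le_self N.cast_nonneg (by norm_num))
    exact_mod_cast this
  have : Nonempty (Fin K ↪ Fin N) := ⟨Fin.castLEEmb hKN⟩
  have h1 : ∑ e : Fin K ↪ Fin N, ∑ k,
      expCount π (spike lo _ hlo hlo' hhi hhi' fun l => some (e l)) T (e k) k ≤
      ∑ _e : Fin K ↪ Fin N, ∑ _k : Fin K, (5 / 8 * T : ℝ) := by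
    rw [Finset.sum_comm]
    refine le_trans ?_ (le_of_eq Finset.sum_comm)
    exact Finset.sum_le_sum fun k _ =>
      sum_expCount_embedding_le hlo hlo' hhi hhi' hδ π T k hNK hT
  obtain ⟨e, -, he⟩ := Finset.exists_le_of_sum_le Finset.univ_nonempty h1
  refine ⟨e, le_trans ?_ (le_regret_spike hlo hlo' hhi hhi' hδ hD e π T)⟩
  have hc : 0 ≤ lo * δ / D ^ 2 := by positivity
  refine mul_le_mul_of_nonneg_left ?_ hc
  simp only [Finset.sum_const, Finset.card_fin, nsmul_eq_mul] at he
  linarith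

end PositionMNL

/-! ### Choice of parameters -/

theorem theorem3 :
    ∃ η : ℝ, 1 / 1000 ≤ η ∧ η = 4 / (675 * Real.sqrt 3) ∧
      ∀ N K T : ℕ, (K : ℝ) ≤ (N : ℝ) / 4 → 4 / 243 * ((K : ℝ) * (N : ℝ)) ≤ (T : ℝ) →
        ∀ π : PositionMNL.Policy N K, ∃ I : PositionMNL.Instance N K,
          η * Real.sqrt ((K : ℝ) * (N : ℝ) * (T : ℝ)) ≤ PositionMNL.regret π I T := by
  have h3 : 0 < √3 := by positivity
  have h3sq : √3 ^ 2 = 3 := Real.sq_sqrt (by norm_num)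
  have h3le : √3 ≤ 2 := Real.sqrt_le_iff.2 ⟨by norm_num, by norm_num⟩
  refine ⟨_, ?_, rfl, ?_⟩
  · rw [div_le_div_iff₀ (by norm_num) (by positivity)]
    linarith
  intro N K T hNK hT π
  -- Without positions the lower bound is 0, and any instance serves.
  rcases K.eq_zero_or_pos with rfl | hKpos
  · refine ⟨PositionMNL.spike 1 1 one_pos le_rfl one_pos le_rfl fun _ => none, ?_⟩
    simpa using PositionMNL.regret_nonneg π _ T
  have hK : (1 : ℝ) ≤ K := by exact_mod_cast hKpos
  have hN : (0 : ℝ) < N := by linarith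
  have hT0 : (0 : ℝ) < T := lt_of_lt_of_le (by positivity) hT
  set w : ℝ := √(K * N * T) with hw
  have hwsq : w ^ 2 = K * N * T := Real.sq_sqrt (by positivity)
  have hw0 : 0 ≤ w := Real.sqrt_nonneg _
  -- That is, `δ = √(27 * K * N / T)`: with `lo = 1 / (128 * K)` the information budget `27/256 * N`
  -- is met with equality.
  obtain ⟨δ, hδ⟩ : ∃ δ : ℝ, δ = 3 * √3 * w / T := ⟨_, rfl⟩
  have hδ0 : 0 ≤ δ := by rw [hδ]; positivity
  have hδT : δ * T = 3 * √3 * w := by rw [hδ]; field_simp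
  have hδsq : δ ^ 2 * T = 27 * (K * N) := by
    have : (δ ^ 2 * T) * T = 27 * (K * N) * T := by
      calc (δ ^ 2 * T) * T = (δ * T) ^ 2 := by ring
        _ = 9 * √3 ^ 2 * w ^ 2 := by rw [hδT]; ring
        _ = 27 * (K * N) * T := by rw [h3sq, hwsq]; ring
    exact mul_right_cancel₀ hT0.ne' this
  -- This is where the lower bound on `T` enters: `27 * 243 / 4 = (81/2) ^ 2`. It keeps `(1 + δ) /
  -- 128` below `1/2`, which makes `D = 3/2` admissible.
  have hδle : δ ≤ 81 / 2 := by
    have h : δ ^ 2 * T ≤ (81 / 2) ^ 2 * T := by rw [hδsq]; linarith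
    exact le_of_sq_le_sq (le_of_mul_le_mul_right h hT0) (by norm_num)
  have hlo : (0 : ℝ) < 1 / (128 * K) := by positivity
  have hhi : 0 < 1 / (128 * K) * (1 + δ) := by positivity
  have hKhi : 1 / (128 * (K : ℝ)) * (1 + δ) * K = (1 + δ) / 128 := by field_simp
  have hhi' : 1 / (128 * K) * (1 + δ) ≤ 1 := by
    have := le_mul_of_one_le_right hhi.le hK
    linarith
  have hlo' : 1 / (128 * (K : ℝ)) ≤ 1 := by nlinarith
  obtain ⟨e, he⟩ := PositionMNL.exists_le_regret_spike hlo hlo' hhi hhi' hδ0 (D := 3 / 2)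
    (by linarith) π T hNK (by
      have : 1 / (128 * (K : ℝ)) * δ ^ 2 / 2 * T = 1 / (256 * K) * (δ ^ 2 * T) := by
        field_simp
        ring
      rw [this, hδsq]
      refine le_of_eq ?_
      field_simp)
  refine ⟨_, le_trans ?_ he⟩
  have h5 : 1 / (128 * (K : ℝ)) * δ / (3 / 2) ^ 2 * (3 / 8 * (K * T)) = δ * T / 768 := by
    field_simp
    ring
  rw [h5, hδT]
  have h6 : 4 / (675 * √3) = 4 * √3 / 2025 := by
    rw [div_eq_div_iff (by positivity) (by norm_num)]
    linear_combination -2700 * h3sq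
  rw [h6]
  -- The construction yields `√3 / 256 * w`, about twice the claimed `4 * √3 / 2025 * w`.
  nlinarith [mul_nonneg h3.le hw0]
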